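/- **Setting.** A buddy system manages a memory region that starts at address $\mathtt{base}$ and has size $\mathtt{total}=\mathtt{min\_size}\cdot 2^{\mathtt{depth}}$, where $\mathtt{min\_size}\ge 1$; it has a parameter $\mathtt{max\_level}\le\mathtt{depth}$, and $\mathtt{max\_size}=\mathtt{total}/2^{\mathtt{max\_level}}$. The nodes of a complete binary tree are indexed by $1,\dots,2^{\mathtt{depth}+1}-1$: the root is $1$ and the children of $n$ are $2n$ (left) and $2n+1$ (right). Put $\mathrm{level}(n)=\lfloor\log_2 n\rfloor$, $\mathrm{size}_n=\mathtt{total}/2^{\mathrm{level}(n)}$ and $\mathrm{start}_n=\mathtt{base}+(n-2^{\mathrm{level}(n)})\,\mathrm{size}_n$. The threads share two arrays, initially zero: $\mathtt{tree}[n]$ holds five status bits, and $\mathtt{index}[k]$ holds a node index. The masks are $\mathtt{OCC\_RIGHT}=1$, $\mathtt{OCC\_LEFT}=2$, $\mathtt{COAL\_RIGHT}=4$, $\mathtt{COAL\_LEFT}=8$, $\mathtt{OCC}=16$, $\mathtt{BUSY}=19$. For a child $c$ of a node, let $occ_c,coal_c$ be the occupancy and coalescing masks of the branch of $c$ (left if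 $c$ is even, right if $c$ is odd), and let $occ'_c,coal'_c$ be those of the other branch. $\mathrm{CAS}(x,a,b)$ atomically stores $b$ in $x$ and succeeds if $x=a$; otherwise it fails and leaves $x$ unchanged. **Procedures.** * $\mathrm{NBAlloc}(s)$: if $s>\mathtt{max\_size}$, return *false*. Let $\ell=\min(\lfloor\log_2(\mathtt{total}/s)\rfloor,\mathtt{depth})$ (and $\ell=\mathtt{depth}$ if $s=0$). Let $i$ start at $2^\ell$. While $i\le 2^{\ell+1}-1$: if $\mathtt{tree}[i]\,\&\,\mathtt{BUSY}\ne0$, increase $i$ by $1$; otherwise let $f=\mathrm{TryAlloc}(i)$; if $f=0$, set $\mathtt{index}[(\mathrm{start}_i-\mathtt{base})/\mathtt{min\_size}]\leftarrow i$ and return $\mathrm{start}_i$; if $f\neq0$, set $i\leftarrow(f+1)\,2^{\mathrm{level}(i)-\mathrm{level}(f)}$. When the scan is exhausted, return NULL. * $\mathrm{TryAlloc}(n)$: if $\mathrm{CAS}(\mathtt{tree}[n],0,\mathtt{BUSY})$ fails, return $n$. Let $cur=n$. While $\mathrm{level}(cur)>\mathtt{max\_level}$: let $c=cur$, $cur\leftarrow\lfloor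 cur/2\rfloor$, and repeat the following until the CAS succeeds: read $v=\mathtt{tree}[cur]$; if $v\,\&\,\mathtt{OCC}\ne0$, run $\mathrm{FreeNode}(n,\mathrm{level}(c))$ and return $cur$; execute $\mathrm{CAS}(\mathtt{tree}[cur],v,(v\,\&\,\neg coal_c)\,|\,occ_c)$. After the climb return $0$. * $\mathrm{NBFree}(a)$: read $n=\mathtt{index}[\lfloor(a-\mathtt{base})/\mathtt{min\_size}\rfloor]$ and run $\mathrm{FreeNode}(n,\mathtt{max\_level})$. * $\mathrm{FreeNode}(n,u)$: let $r=n$, $cur=\lfloor n/2\rfloor$. While $\mathrm{level}(r)>u$: repeat reading $v=\mathtt{tree}[cur]$ and executing $\mathrm{CAS}(\mathtt{tree}[cur],v,v\,|\,coal_r)$ until the CAS succeeds; if $v\,\&\,occ'_r\neq0$ and $v\,\&\,coal'_r=0$, leave the loop; otherwise $r\leftarrow cur$, $cur\leftarrow\lfloor cur/2\rfloor$. Then set $\mathtt{tree}[n]\leftarrow0$ and, if $\mathrm{level}(n)\ne u$, run $\mathrm{Unmark}(n,u)$. * $\mathrm{Unmark}(n,u)$: let $cur=n$. Do: $c\leftarrow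 cur$, $cur\leftarrow\lfloor cur/2\rfloor$, and repeat the following until the CAS succeeds: read $v=\mathtt{tree}[cur]$; if $v\,\&\,coal_c=0$, return; let $w=v\,\&\,\neg(occ_c\,|\,coal_c)$ and execute $\mathrm{CAS}(\mathtt{tree}[cur],v,w)$; while $\mathrm{level}(cur)>u$ and $w\,\&\,occ'_c=0$. **Executions.** There is a finite set of threads. At the start every thread is idle and both arrays are zero. An idle thread may invoke $\mathrm{NBAlloc}(s)$ or $\mathrm{NBFree}(a)$ at any time, with any natural number $s$ or $a$; a thread that has finished its operation may return, which completes the invocation and makes the thread idle. The steps of a thread are atomic, each containing at most one read, write or CAS on the shared arrays. An infinite execution is any infinite sequence of steps, each taken by an arbitrary thread; no fairness is assumed. (So that each call is defined: $a-\mathtt{base}$ is read as $0$ if $a<\mathtt{base}$, all array entries that do not correspond to a node or to an allocation unit exist and are initially $0$, and $\mathrm{level}(0)=0$. These conventions matter only for calls of NBFree with an address that was never delivered.) **Theorem.** NBAlloc and NBFree are lock-free: in every infinite execution, after every point in time some invocation of NBAlloc or NBFree completes, i.e. infinitely many invocations complete. -/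

import Mathlib

namespace NBBuddy

/-- The five status bits of a node: from the most significant one, `occupied`, `left_coalescent`,
`right_coalescent`, `left_occupied`, `right_occupied`. -/
abbrev Bits := BitVec 5

def OCC_RIGHT : Bits := 0x1
def OCC_LEFT : Bits := 0x2
def COAL_RIGHT : Bits := 0x4
def COAL_LEFT : Bits := 0x8
def OCC : Bits := 0x10
def BUSY : Bits := OCC ||| OCC_LEFT ||| OCC_RIGHT

def cleanCoal (val : Bits) (child : ℕ) : Bits := val &&& ~~~(COAL_LEFT >>> (child % 2))
def mark (val : Bits) (child : ℕ) : Bits := val ||| (OCC_LEFT >>> (child % 2))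
def unmark (val : Bits) (child : ℕ) : Bits :=
  val &&& ~~~((OCC_LEFT ||| COAL_LEFT) >>> (child % 2))
abbrev IsCoal (val : Bits) (child : ℕ) : Prop := val &&& (COAL_LEFT >>> (child % 2)) ≠ 0
abbrev IsOccBuddy (val : Bits) (child : ℕ) : Prop := val &&& (OCC_RIGHT <<< (child % 2)) ≠ 0
abbrev IsCoalBuddy (val : Bits) (child : ℕ) : Prop := val &&& (COAL_RIGHT <<< (child % 2)) ≠ 0
abbrev IsFree (val : Bits) : Prop := val &&& BUSY = 0

/-- The static parameters of a buddy system: a memory region starting at `baseAddress`, divided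
into `2 ^ depth` allocation units of size `minSize`; single requests are served by nodes at
levels from `maxLevel` to `depth`. -/
structure Config where
  baseAddress : ℕ
  minSize : ℕ
  minSize_pos : 0 < minSize
  depth : ℕ
  maxLevel : ℕ
  maxLevel_le : maxLevel ≤ depth

namespace Config

def totalMemory (c : Config) : ℕ := c.minSize * 2 ^ c.depth

/-- The size of the largest request that can be served, that is of a node at level `maxLevel`. -/
def maxSize (c : Config) : ℕ := c.totalMemory / 2 ^ c.maxLevel

end Config

/-- The level of the node with index `n` (the root has index `1` and level `0`). -/
def level (n : ℕ) : ℕ := Nat.log 2 n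

def sizeOf (c : Config) (n : ℕ) : ℕ := c.totalMemory / 2 ^ level n

def starting (c : Config) (n : ℕ) : ℕ := c.baseAddress + (n - 2 ^ level n) * sizeOf c n

/-- The level `⌊log₂ (totalMemory / size)⌋`, bounded above by `depth`, that serves a request of
`size` bytes. A request of size `0` is rounded to one allocation unit, as all the requests smaller
than `minSize` are. -/
def targetLevel (c : Config) (size : ℕ) : ℕ :=
  if size = 0 then c.depth else min (Nat.log 2 (c.totalMemory / size)) c.depth

/-- The shared memory: the arrays `tree[]` and `index[]`. -/
structure Mem where
  tree : ℕ → Bits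
  index : ℕ → ℕ

def Mem.init : Mem := ⟨fun _ => 0, fun _ => 0⟩

def Mem.setTree (m : Mem) (n : ℕ) (v : Bits) : Mem := { m with tree := Function.update m.tree n v }

def Mem.setIndex (m : Mem) (k n : ℕ) : Mem := { m with index := Function.update m.index k n }

/-- What an invocation of the interface delivers: `tooLarge` is the value `false` returned on a
request beyond `maxSize`, `null` is the value `NULL` returned when no free node was found,
`address a` is a successful allocation and `released` is the end of a memory release. -/
inductive Result where
  | tooLarge
  | null
  | address (a : ℕ)
  | released

/-- The invocations of the interface: `NBAlloc(size)` and `NBFree(addr)`. -/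
inductive Op where
  | nbAlloc (size : ℕ)
  | nbFree (addr : ℕ)

/-- The place where control goes at the end of `FreeNode`: back to `NBFree`, or back to the
`TryAlloc` whose attempt to allocate node `i` was stopped at the node `failedAt`, and that then
returns `failedAt` to an `NBAlloc` scanning the nodes up to `untilTo`. -/
inductive Cont where
  | nbFree
  | tryAlloc (untilTo i failedAt : ℕ)

/-- The control points of the procedures, with the values of the live local variables. -/
inductive PC where
  /-- `NBAlloc`: test of the size, computation of the range of nodes to be scanned. -/
  | allocEntry (size : ℕ)
  /-- `NBAlloc`: guard of the scan, `i ≤ untilTo`. -/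
  | allocGuard (untilTo i : ℕ)
  /-- `NBAlloc`: read of `tree[i]` and test `is_free`. -/
  | allocTest (untilTo i : ℕ)
  /-- `TryAlloc(n)`: `CAS(tree[n], 0, BUSY)`. -/
  | tryReserve (untilTo n : ℕ)
  /-- `TryAlloc(n)`: guard of the climb, `level current > maxLevel`. -/
  | tryGuard (untilTo n current : ℕ)
  /-- `TryAlloc(n)`: read of `tree[current]` and test of its bit `OCC`. -/
  | tryRead (untilTo n child current : ℕ)
  /-- `TryAlloc(n)`: CAS on `tree[current]`, expecting the value `currVal`. -/
  | tryCAS (untilTo n child current : ℕ) (currVal : Bits)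
  /-- `NBAlloc`, after a successful `TryAlloc(i)`: write of the entry of `index[]`. -/
  | allocPublish (i : ℕ)
  /-- `NBAlloc`, after a `TryAlloc(i)` that returned `failedAt`: choice of the next candidate. -/
  | allocSkip (untilTo i failedAt : ℕ)
  /-- `NBFree`: read of the entry of `index[]` and call of `FreeNode`. -/
  | nbFreeEntry (addr : ℕ)
  /-- `FreeNode(n, upperBound)`: guard of the climb, `level runner > upperBound`. -/
  | freeGuard (n upperBound runner current : ℕ) (k : Cont)
  /-- `FreeNode(n, upperBound)`: read of `tree[current]`. -/
  | freeRead (n upperBound runner current : ℕ) (k : Cont)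
  /-- `FreeNode(n, upperBound)`: CAS on `tree[current]`, expecting the value `curVal`. -/
  | freeCAS (n upperBound runner current : ℕ) (curVal : Bits) (k : Cont)
  /-- `FreeNode(n, upperBound)`: `tree[n] ← 0`, then possibly call of `Unmark`. -/
  | freeRelease (n upperBound : ℕ) (k : Cont)
  /-- `Unmark`: read of `tree[current]` and test `is_coal`. -/
  | unmarkRead (upperBound child current : ℕ) (k : Cont)
  /-- `Unmark`: CAS on `tree[current]`, expecting the value `currVal`. -/
  | unmarkCAS (upperBound child current : ℕ) (currVal : Bits) (k : Cont)

/-- A thread is outside the allocator, or executes one of its procedures, or is about to return to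
the caller of the interface. -/
inductive ThreadState where
  | idle
  | running (pc : PC)
  | returning (r : Result)

/-- The first control point of an invocation. -/
def Op.entry : Op → PC
  | .nbAlloc size => .allocEntry size
  | .nbFree addr => .nbFreeEntry addr

/-- Return from `FreeNode`. -/
def Cont.resume : Cont → ThreadState
  | .nbFree => .returning .released
  | .tryAlloc untilTo i failedAt => .running (.allocSkip untilTo i failedAt)

/-- One step of a thread at a control point. It performs at most one access (read, write or CAS)
to the shared memory, atomically, together with local computations. A CAS stores its new value if
the present value is the expected one and leaves the memory unchanged otherwise. -/
def next (c : Config) (m : Mem) : PC → Mem × ThreadState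
  | .allocEntry size =>
      if c.maxSize < size then (m, .returning .tooLarge)
      else
        (m, .running (.allocGuard (2 ^ (targetLevel c size + 1) - 1) (2 ^ targetLevel c size)))
  | .allocGuard untilTo i =>
      if i ≤ untilTo then (m, .running (.allocTest untilTo i)) else (m, .returning .null)
  | .allocTest untilTo i =>
      if IsFree (m.tree i) then (m, .running (.tryReserve untilTo i))
      else (m, .running (.allocGuard untilTo (i + 1)))
  | .tryReserve untilTo n =>
      if m.tree n = 0 then (m.setTree n BUSY, .running (.tryGuard untilTo n n))
      else (m, .running (.allocSkip untilTo n n))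
  | .tryGuard untilTo n current =>
      if c.maxLevel < level current then
        (m, .running (.tryRead untilTo n current (current >>> 1)))
      else (m, .running (.allocPublish n))
  | .tryRead untilTo n child current =>
      if m.tree current &&& OCC ≠ 0 then
        (m, .running (.freeGuard n (level child) n (n >>> 1) (.tryAlloc untilTo n current)))
      else (m, .running (.tryCAS untilTo n child current (m.tree current)))
  | .tryCAS untilTo n child current currVal =>
      if m.tree current = currVal then
        (m.setTree current (mark (cleanCoal currVal child) child),
          .running (.tryGuard untilTo n current))
      else (m, .running (.tryRead untilTo n child current))
  | .allocPublish i =>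
      (m.setIndex ((starting c i - c.baseAddress) / c.minSize) i,
        .returning (.address (starting c i)))
  | .allocSkip untilTo i failedAt =>
      (m, .running (.allocGuard untilTo ((failedAt + 1) * 2 ^ (level i - level failedAt))))
  | .nbFreeEntry addr =>
      (m, .running (.freeGuard (m.index ((addr - c.baseAddress) / c.minSize)) c.maxLevel
        (m.index ((addr - c.baseAddress) / c.minSize))
        (m.index ((addr - c.baseAddress) / c.minSize) >>> 1) .nbFree))
  | .freeGuard n upperBound runner current k =>
      if upperBound < level runner then (m, .running (.freeRead n upperBound runner current k))
      else (m, .running (.freeRelease n upperBound k))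
  | .freeRead n upperBound runner current k =>
      (m, .running (.freeCAS n upperBound runner current (m.tree current) k))
  | .freeCAS n upperBound runner current curVal k =>
      if m.tree current = curVal then
        (m.setTree current (curVal ||| (COAL_LEFT >>> (runner % 2))),
          if IsOccBuddy curVal runner ∧ ¬ IsCoalBuddy curVal runner then
            .running (.freeRelease n upperBound k)
          else .running (.freeGuard n upperBound current (current >>> 1) k))
      else (m, .running (.freeRead n upperBound runner current k))
  | .freeRelease n upperBound k =>
      (m.setTree n 0,
        if level n ≠ upperBound then .running (.unmarkRead upperBound n (n >>> 1) k)
        else k.resume)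
  | .unmarkRead upperBound child current k =>
      if IsCoal (m.tree current) child then
        (m, .running (.unmarkCAS upperBound child current (m.tree current) k))
      else (m, k.resume)
  | .unmarkCAS upperBound child current currVal k =>
      if m.tree current = currVal then
        (m.setTree current (unmark currVal child),
          if upperBound < level current ∧ ¬ IsOccBuddy (unmark currVal child) child then
            .running (.unmarkRead upperBound current (current >>> 1) k)
          else k.resume)
      else (m, .running (.unmarkRead upperBound child current k))

/-- What is observed at a step: an invocation, a step inside the procedures, or the completion of
an invocation. -/
inductive Event where
  | invoke (op : Op)
  | internal
  | complete (r : Result)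

/-- The steps of one thread. An idle thread may invoke any operation, with any argument. -/
inductive ThreadStep (c : Config) : Mem → ThreadState → Event → Mem → ThreadState → Prop where
  | invoke (m : Mem) (op : Op) :
      ThreadStep c m .idle (.invoke op) m (.running op.entry)
  | internal (m : Mem) (pc : PC) :
      ThreadStep c m (.running pc) .internal (next c m pc).1 (next c m pc).2
  | complete (m : Mem) (r : Result) :
      ThreadStep c m (.returning r) (.complete r) m .idle

/-- A global state of the system with set of threads `T`. -/
structure State (T : Type*) where
  mem : Mem
  thread : T → ThreadState

/-- At start-up both arrays are zero and no thread is inside the allocator. -/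
def State.init (T : Type*) : State T := ⟨Mem.init, fun _ => .idle⟩

/-- Thread `t` takes a step; the local states of the other threads do not change. -/
def Step (c : Config) {T : Type*} (s₁ : State T) (t : T) (e : Event) (s₂ : State T) : Prop :=
  ThreadStep c s₁.mem (s₁.thread t) e s₂.mem (s₂.thread t) ∧
    ∀ u, u ≠ t → s₂.thread u = s₁.thread u

/-- An infinite execution: an arbitrary interleaving, with no fairness requirement, of steps of
the threads. -/
structure Execution (c : Config) (T : Type*) where
  state : ℕ → State T
  actor : ℕ → T
  event : ℕ → Event
  init : state 0 = State.init T
  step : ∀ k, Step c (state k) (actor k) (event k) (state (k + 1))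

/-- Lock-freedom of the operations `NBAlloc` and `NBFree`: however the steps of the threads are
interleaved, infinitely often an invocation completes. -/
def LockFree (c : Config) (T : Type*) : Prop :=
  ∀ E : Execution c T, ∀ k : ℕ, ∃ j, k ≤ j ∧ ∃ r, E.event j = .complete r

end NBBuddy

namespace NBBuddy

/-! Each thread carries a rank depending only on its local state, so no other thread can change it.
A step that does not complete an invocation lowers the rank of its actor, except in the retry loops:
there a read followed by the CAS, or a failed CAS followed by a new read, keeps the rank. Such a
step leaves the tree unchanged and lowers the actor's staleness (stale CAS 2, read 1, fresh CAS 0).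
A successful CAS may make other threads stale, but it lowers its actor's rank.

Hence the pair (all ranks, all stalenesses), ordered lexicographically with each family compared
pointwise, falls at every step other than a completion (`Step.measure_lt`, from `next_progress`).
For finitely many threads this order is well-founded, so completions cannot stop. Only relations
between local variables (`PC.WellFormed`) are needed; nothing is assumed about the contents of the
arrays, so arbitrary calls of NBFree are covered. -/

/-! ### Rank and staleness -/

/-- The number of candidates, counting the present one, left to the scan that control will
return to. -/
def Cont.candidates : Cont → ℕ
  | .nbFree => 0
  | .tryAlloc untilTo i _ => untilTo + 1 - i

/-- The progress of an invocation, compared lexicographically: not yet started, candidates left to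
the scan, phase in the treatment of a candidate, distance to the end of a climb. -/
abbrev Rank : Type := ℕ ×ₗ ℕ ×ₗ ℕ ×ₗ ℕ

def Rank.mk (a b p d : ℕ) : Rank := toLex (a, toLex (b, toLex (p, d)))

theorem Rank.mk_lt_mk {a b p d a' b' p' d' : ℕ} :
    Rank.mk a b p d < Rank.mk a' b' p' d' ↔
      a < a' ∨ a = a' ∧ (b < b' ∨ b = b' ∧ (p < p' ∨ p = p' ∧ d < d')) := by
  simp [Rank.mk, Prod.Lex.toLex_lt_toLex]

/-- The phases decrease from scan to reservation, climb, release, unmarking and skip; the rise back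
to 9 is paid for by a lost candidate. The read and the CAS of a retry loop share a rank. Odd and
even values of the distance place a guard at a node just below the retry loop at that node. -/
def PC.rank : PC → Rank
  | .allocEntry _ => .mk 1 0 0 0
  | .nbFreeEntry _ => .mk 1 0 0 0
  | .allocGuard untilTo i => .mk 0 (untilTo + 1 - i) 9 0
  | .allocTest untilTo i => .mk 0 (untilTo + 1 - i) 8 0
  | .tryReserve untilTo n => .mk 0 (untilTo + 1 - n) 7 0
  | .tryGuard untilTo n current => .mk 0 (untilTo + 1 - n) 6 (2 * current + 1)
  | .tryRead untilTo n _ current => .mk 0 (untilTo + 1 - n) 6 (2 * current + 2)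
  | .tryCAS untilTo n _ current _ => .mk 0 (untilTo + 1 - n) 6 (2 * current + 2)
  | .allocPublish _ => .mk 0 0 1 0
  | .allocSkip untilTo i _ => .mk 0 (untilTo + 1 - i) 2 0
  | .freeGuard _ _ runner _ k => .mk 0 k.candidates 5 (2 * runner + 1)
  | .freeRead _ _ _ current k => .mk 0 k.candidates 5 (2 * current + 2)
  | .freeCAS _ _ _ current _ k => .mk 0 k.candidates 5 (2 * current + 2)
  | .freeRelease _ _ k => .mk 0 k.candidates 4 0
  | .unmarkRead _ _ current k => .mk 0 k.candidates 3 current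
  | .unmarkCAS _ _ current _ k => .mk 0 k.candidates 3 current

def ThreadState.rank : ThreadState → Rank
  | .idle => .mk 2 0 0 0
  | .running pc => pc.rank
  | .returning _ => .mk 0 0 0 0

/-- The number of steps, in a memory that does not change, before the next CAS succeeds, for a
thread in one of the loops that repeat a read and a CAS. -/
def ThreadState.staleness (tree : ℕ → Bits) : ThreadState → ℕ
  | .running (.tryRead ..) => 1
  | .running (.freeRead ..) => 1
  | .running (.unmarkRead ..) => 1
  | .running (.tryCAS _ _ _ current v) => if tree current = v then 0 else 2
  | .running (.freeCAS _ _ _ current v _) => if tree current = v then 0 else 2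
  | .running (.unmarkCAS _ _ current v _) => if tree current = v then 0 else 2
  | _ => 0

/-! ### Ancestors in the tree -/

/-- Node `a` lies on the path from node `n` to the root. -/
def IsAncestor (a n : ℕ) : Prop := 0 < a ∧ ∃ j, a = n >>> j

theorem IsAncestor.refl {n : ℕ} (h : 0 < n) : IsAncestor n n := ⟨h, 0, rfl⟩

theorem level_eq_zero_of_lt_two {n : ℕ} (h : n < 2) : level n = 0 := Nat.log_of_lt h

theorem two_le_of_lt_level {n u : ℕ} (h : u < level n) : 2 ≤ n := by
  by_contra hn
  rw [level_eq_zero_of_lt_two (by omega)] at h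
  omega

theorem shiftRight_one_le (n : ℕ) : 2 * (n >>> 1) ≤ n := by
  rw [Nat.shiftRight_eq_div_pow]
  omega

theorem IsAncestor.shiftRight_one {a n u : ℕ} (h : IsAncestor a n) (ha : u < level a) :
    IsAncestor (a >>> 1) n := by
  have h2 := two_le_of_lt_level ha
  obtain ⟨_, j, rfl⟩ := h
  refine ⟨?_, j + 1, by rw [Nat.shiftRight_add]⟩
  generalize n >>> j = a at h2
  rw [Nat.shiftRight_eq_div_pow]
  omega

/-- The scan resumes, after an attempt stopped at `a`, beyond all the descendants of `a`. -/
theorem IsAncestor.lt_skip {a n : ℕ} (h : IsAncestor a n) :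
    n < (a + 1) * 2 ^ (level n - level a) := by
  obtain ⟨ha, j, rfl⟩ := h
  rw [Nat.shiftRight_eq_div_pow] at ha ⊢
  -- Positivity of the ancestor gives `j ≤ level n`, so the truncated subtraction is exact.
  have hj : level n - level (n / 2 ^ j) = j := by
    have hle : 2 ^ j ≤ n := by
      by_contra hlt
      simp [Nat.div_eq_of_lt (not_le.mp hlt)] at ha
    have := Nat.le_log_of_pow_le one_lt_two hle
    rw [level, level, Nat.log_div_base_pow]
    omega
  rw [hj, mul_comm]
  exact Nat.lt_mul_div_succ n (by positivity)

/-! ### Invariant of the local variables -/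

def Cont.WellFormed : Cont → Prop
  | .nbFree => True
  | .tryAlloc untilTo i failedAt => i ≤ untilTo ∧ IsAncestor failedAt i

/-- The relations between the local variables of a thread on which the termination of the loops
depends. -/
def PC.WellFormed : PC → Prop
  | .allocEntry _ => True
  | .nbFreeEntry _ => True
  | .allocGuard _ i => 0 < i
  | .allocTest untilTo i => 0 < i ∧ i ≤ untilTo
  | .tryReserve untilTo n => 0 < n ∧ n ≤ untilTo
  | .tryGuard untilTo n current => n ≤ untilTo ∧ IsAncestor current n
  | .tryRead untilTo n _ current => n ≤ untilTo ∧ IsAncestor current n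
  | .tryCAS untilTo n _ current _ => n ≤ untilTo ∧ IsAncestor current n
  | .allocPublish _ => True
  | .allocSkip untilTo i failedAt => i ≤ untilTo ∧ IsAncestor failedAt i
  | .freeGuard _ _ runner current k => current = runner >>> 1 ∧ k.WellFormed
  | .freeRead _ _ runner current k => 0 < current ∧ current = runner >>> 1 ∧ k.WellFormed
  | .freeCAS _ _ runner current _ k => 0 < current ∧ current = runner >>> 1 ∧ k.WellFormed
  | .freeRelease _ _ k => k.WellFormed
  | .unmarkRead _ _ _ k => k.WellFormed
  | .unmarkCAS _ _ _ _ k => k.WellFormed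

def ThreadState.WellFormed : ThreadState → Prop
  | .running pc => pc.WellFormed
  | _ => True

theorem Cont.WellFormed.resume {k : Cont} (h : k.WellFormed) : k.resume.WellFormed := by
  cases k <;> exact h

/-- The bound 2 is the phase of `allocSkip`, the only running state in which `FreeNode` can resume;
the candidate is still the same there. -/
theorem Cont.rank_resume_lt (k : Cont) {p d : ℕ} (hp : 2 < p) :
    k.resume.rank < .mk 0 k.candidates p d := by
  cases k
  · simp only [Cont.resume, ThreadState.rank, Cont.candidates, Rank.mk_lt_mk]
    grind
  · simp only [Cont.resume, ThreadState.rank, PC.rank, Cont.candidates, Rank.mk_lt_mk]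
    grind

theorem wellFormed_next (c : Config) (m : Mem) {pc : PC} (h : pc.WellFormed) :
    (next c m pc).2.WellFormed := by
  cases pc with
  | allocEntry size =>
    simp only [next]
    split_ifs
    · trivial
    · exact Nat.two_pow_pos _
  | allocGuard untilTo i =>
    simp only [next]
    split_ifs with hi
    · exact ⟨h, hi⟩
    · trivial
  | allocTest untilTo i =>
    simp only [next]
    split_ifs
    · exact h
    · exact Nat.succ_pos i
  | tryReserve untilTo n =>
    simp only [next]
    split_ifs <;> exact ⟨h.2, .refl h.1⟩
  | tryGuard untilTo n current =>
    simp only [next]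
    split_ifs with hl
    · exact ⟨h.1, h.2.shiftRight_one hl⟩
    · trivial
  | tryRead untilTo n child current =>
    simp only [next]
    split_ifs
    · exact ⟨rfl, h⟩
    · exact h
  | tryCAS untilTo n child current v =>
    simp only [next]
    split_ifs <;> exact h
  | allocPublish i => trivial
  | allocSkip untilTo i failedAt => exact (Nat.zero_le _).trans_lt h.2.lt_skip
  | nbFreeEntry addr => exact ⟨rfl, trivial⟩
  | freeGuard n u runner current k =>
    obtain ⟨rfl, hk⟩ := h
    simp only [next]
    split_ifs with hl
    · have h2 := two_le_of_lt_level hl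
      exact ⟨((IsAncestor.refl (by omega)).shiftRight_one hl).1, rfl, hk⟩
    · exact hk
  | freeRead n u runner current k => exact h
  | freeCAS n u runner current v k =>
    simp only [next]
    split_ifs
    · exact h.2.2
    · exact ⟨rfl, h.2.2⟩
    · exact h
  | freeRelease n u k =>
    simp only [next]
    split_ifs
    · exact h
    · exact Cont.WellFormed.resume h
  | unmarkRead u child current k =>
    simp only [next]
    split_ifs
    · exact h
    · exact Cont.WellFormed.resume h
  | unmarkCAS u child current v k =>
    simp only [next]
    split_ifs
    · exact h
    · exact Cont.WellFormed.resume h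
    · exact h

/-! ### Progress of a single step -/

/-- An internal step makes progress, or else belongs to a loop that repeats a read and a CAS, in
which case it leaves the tree unchanged. -/
theorem next_progress (c : Config) (m : Mem) {pc : PC} (h : pc.WellFormed) :
    (next c m pc).2.rank < pc.rank ∨
      (next c m pc).2.rank = pc.rank ∧ (next c m pc).1.tree = m.tree ∧
        (next c m pc).2.staleness m.tree < (ThreadState.running pc).staleness m.tree := by
  cases pc with
  | allocEntry size =>
    left
    simp only [next]
    split_ifs <;> simp [ThreadState.rank, PC.rank, Rank.mk_lt_mk]
  | allocGuard untilTo i =>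
    left
    simp only [next]
    split_ifs <;> simp only [ThreadState.rank, PC.rank, Rank.mk_lt_mk] <;> grind
  | allocTest untilTo i =>
    left
    have hi := h.2
    simp only [next]
    split_ifs <;> simp only [ThreadState.rank, PC.rank, Rank.mk_lt_mk] <;> grind
  | tryReserve untilTo n =>
    left
    simp only [next]
    split_ifs <;> simp [ThreadState.rank, PC.rank, Rank.mk_lt_mk]
  | tryGuard untilTo n current =>
    left
    simp only [next]
    split_ifs with hl <;> simp only [ThreadState.rank, PC.rank, Rank.mk_lt_mk]
    -- For `current ≥ 2`, `2 * (current >>> 1) + 2 ≤ current + 2 < 2 * current + 1`.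
    · have := two_le_of_lt_level hl
      have := shiftRight_one_le current
      grind
    · grind
  | tryRead untilTo n child current =>
    simp only [next]
    split_ifs
    · left
      simp [ThreadState.rank, PC.rank, Cont.candidates, Rank.mk_lt_mk]
    · right
      simp [ThreadState.rank, PC.rank, ThreadState.staleness]
  | tryCAS untilTo n child current v =>
    simp only [next]
    split_ifs with hv
    · left
      simp [ThreadState.rank, PC.rank, Rank.mk_lt_mk]
    · right
      simp [ThreadState.rank, PC.rank, ThreadState.staleness, hv]
  | allocPublish i =>
    left
    simp [next, ThreadState.rank, PC.rank, Rank.mk_lt_mk]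
  | allocSkip untilTo i failedAt =>
    left
    have hi := h.1
    have hskip := h.2.lt_skip
    simp only [next, ThreadState.rank, PC.rank, Rank.mk_lt_mk]
    -- As `i ≤ untilTo`, the count `untilTo + 1 - i` is positive, so moving past `i` strictly lowers
    -- it.
    exact .inr ⟨trivial, .inl (by omega)⟩
  | nbFreeEntry addr =>
    left
    simp [next, ThreadState.rank, PC.rank, Rank.mk_lt_mk]
  | freeGuard n u runner current k =>
    left
    obtain ⟨rfl, -⟩ := h
    simp only [next]
    split_ifs with hl <;> simp only [ThreadState.rank, PC.rank, Rank.mk_lt_mk]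
    · have := two_le_of_lt_level hl
      have := shiftRight_one_le runner
      grind
    · grind
  | freeRead n u runner current k =>
    right
    simp [next, ThreadState.rank, PC.rank, ThreadState.staleness]
  | freeCAS n u runner current v k =>
    simp only [next]
    split_ifs with hv
    · left
      simp [ThreadState.rank, PC.rank, Rank.mk_lt_mk]
    · left
      have := h.1
      simp only [ThreadState.rank, PC.rank, Rank.mk_lt_mk]
      grind
    · right
      simp [ThreadState.rank, PC.rank, ThreadState.staleness, hv]
  | freeRelease n u k =>
    left
    simp only [next]
    split_ifs
    · simp [ThreadState.rank, PC.rank, Rank.mk_lt_mk]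
    · exact k.rank_resume_lt (by omega)
  | unmarkRead u child current k =>
    simp only [next]
    split_ifs
    · right
      simp [ThreadState.rank, PC.rank, ThreadState.staleness]
    · exact .inl (k.rank_resume_lt (by omega))
  | unmarkCAS u child current v k =>
    simp only [next]
    split_ifs with hv hl
    · left
      have := two_le_of_lt_level hl.1
      have := shiftRight_one_le current
      simp only [ThreadState.rank, PC.rank, Rank.mk_lt_mk]
      grind
    · exact .inl (k.rank_resume_lt (by omega))
    · right
      simp [ThreadState.rank, PC.rank, ThreadState.staleness, hv]

theorem ThreadStep.wellFormed {c : Config} {m m' : Mem} {s s' : ThreadState} {e : Event}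
    (h : ThreadStep c m s e m' s') (hs : s.WellFormed) : s'.WellFormed := by
  cases h with
  | invoke op => cases op <;> trivial
  | internal pc => exact wellFormed_next c m hs
  | complete r => trivial

theorem ThreadStep.progress {c : Config} {m m' : Mem} {s s' : ThreadState} {e : Event}
    (h : ThreadStep c m s e m' s') (hs : s.WellFormed) (he : ∀ r, e ≠ .complete r) :
    s'.rank < s.rank ∨
      s'.rank = s.rank ∧ m'.tree = m.tree ∧ s'.staleness m.tree < s.staleness m.tree := by
  cases h with
  | invoke op =>
    left
    cases op <;> simp [Op.entry, ThreadState.rank, PC.rank, Rank.mk_lt_mk]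
  | internal pc => exact next_progress c m hs
  | complete r => exact absurd rfl (he r)

/-! ### The global measure -/

/-- The quantity that decreases with every step that does not complete an invocation. -/
def State.measure {T : Type*} (s : State T) : (T → Rank) ×ₗ (T → ℕ) :=
  toLex (fun t => (s.thread t).rank, fun t => (s.thread t).staleness s.mem.tree)

theorem Step.measure_lt {c : Config} {T : Type*} {s₁ s₂ : State T} {t : T} {e : Event}
    (h : Step c s₁ t e s₂) (hs : (s₁.thread t).WellFormed) (he : ∀ r, e ≠ .complete r) :
    s₂.measure < s₁.measure := by
  obtain ⟨ht, hu⟩ := h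
  rw [State.measure, State.measure, Prod.Lex.toLex_lt_toLex]
  rcases ht.progress hs he with hlt | ⟨heq, hmem, hlt⟩
  · refine .inl (Pi.lt_def.mpr ⟨fun u => ?_, t, hlt⟩)
    by_cases hut : u = t
    · exact hut ▸ hlt.le
    · simp only [hu u hut, le_refl]
  -- With the tree unchanged, the other threads keep their staleness.
  · refine .inr ⟨funext fun u => ?_, Pi.lt_def.mpr ⟨fun u => ?_, t, ?_⟩⟩
    · by_cases hut : u = t
      · exact hut ▸ heq
      · simp only [hu u hut]
    · by_cases hut : u = t
      · simpa only [hut, hmem] using hlt.le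
      · simp only [hu u hut, hmem, le_refl]
    · simpa only [hmem] using hlt

theorem Execution.wellFormed {c : Config} {T : Type*} (E : Execution c T) (k : ℕ) (t : T) :
    ((E.state k).thread t).WellFormed := by
  induction k with
  | zero => rw [E.init]; trivial
  | succ k ih =>
    by_cases h : t = E.actor k
    · subst h
      exact (E.step k).1.wellFormed ih
    · rw [(E.step k).2 t h]
      exact ih

end NBBuddy

theorem mainTheorem1 (c : NBBuddy.Config) (T : Type*) [Finite T] : NBBuddy.LockFree c T := by
  intro E k
  by_contra! hk
  have hanti : StrictAnti fun j => (E.state (k + j)).measure :=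
    strictAnti_nat_of_succ_lt fun j =>
      (E.step (k + j)).measure_lt (E.wellFormed _ _) (hk (k + j) (Nat.le_add_right k j))
  -- Finiteness of `T` enters here: it makes the pointwise orders on `T → Rank` and `T → ℕ`
  -- well-founded.
  exact not_strictAnti_of_wellFoundedLT _ hanti
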